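/- All graphs are simple, finite, undirected, and have at least one vertex. Let $G$ be a graph and let $B\subseteq V(G)$ be the set of blue vertices, all other vertices being white. By the positive semidefinite (PSD) color change rule, a blue vertex $u$ can force a white vertex $w$ to become blue if, for some connected component of $G-B$ with vertex set $W$, $w$ is the only white neighbor of $u$ in $G[B\cup W]$; this force is denoted $u\to w$. A set of PSD forces of $B$ is the set $\mathcal F$ of all forces in an ordered list of forces that can be performed one after another starting with exactly $B$ blue and after which no further force is possible. Put $\mathcal F^{[0]}=B$ and let $\mathcal F^{[s+1]}$ be the union of $\mathcal F^{[s]}$ and the set of all $w$ for which some $(u\to w)\in\mathcal F$ is a valid PSD force when exactly the vertices of $\mathcal F^{[s]}$ are blue. Let $\operatorname{pt}_+(G;\mathcal F)$ be the least $s\ge 0$ with $\mathcal F^{[s]}=V(G)$ (and $\infty$ if there is none), let $\operatorname{pt}_+(G;B)$ be the minimum of $\operatorname{pt}_+(G;\mathcal F)$ over all sets $\mathcal F$ of PSD forces of $B$, and let $\operatorname{th}_+(G)=\min_{B\subseteq V(G)}\bigl(|B|+\operatorname{pt}_+(G;B)\bigr)$ be the PSD throttling number of $G$. For integers $k>0$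 and $b\ge 0$ let $T_{k,b}$ be the rooted tree of height $b$ in which every vertex of depth less than $b$ has exactly $k$ children. In the Cartesian product $K_a\,\square\,T_{k,b}$, the tree edges are the edges in the copies of $T_{k,b}$ and the complete edges are the edges in the copies of $K_a$. **Theorem.** Let $G$ be a graph and let $t$ be a positive integer. Then $\operatorname{th}_+(G)\le t$ if and only if there exist integers $a,k>0$ and $b\ge 0$ such that $a+b=t$ and $G$ is (up to isomorphism) obtained from $K_a\,\square\,T_{k,b}$ by contracting tree edges and/or deleting complete edges. -/

import Mathlib

namespace PSDThrottling

/-! ### Color change rules, sets of forces, propagation time -/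

section ColorChange

variable {V : Type*}

/-- A color change rule on the vertex set `V`: `R B u w` says that `u` may force the white vertex
`w` to become blue when `B` is the set of blue vertices (and the vertices outside `B` are white). -/
abbrev ColorChangeRule (V : Type*) := Set V → V → V → Prop

/-- Chronological lists of `R` forces of `B`: ordered lists of forces `(u, w)` (read `u → w`) that
can be performed consecutively, starting with `B` blue, and after which no further force is
possible. -/
inductive IsChronologicalList (R : ColorChangeRule V) : Set V → List (V × V) → Prop
  | nil {B : Set V} (h : ∀ u w : V, ¬ R B u w) : IsChronologicalList R B []
  | cons {B : Set V} {u w : V} {L : List (V × V)} (h : R B u w)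
      (hL : IsChronologicalList R (insert w B) L) : IsChronologicalList R B ((u, w) :: L)

/-- `F` is a set of `R` forces of `B`: the set of forces in some chronological list. -/
def IsSetOfForces (R : ColorChangeRule V) (B : Set V) (F : Set (V × V)) : Prop :=
  ∃ L : List (V × V), IsChronologicalList R B L ∧ F = {p | p ∈ L}

/-- The set of vertices that are blue at time `t`, when at each time step all forces of `F` that
are valid at that moment are performed simultaneously, starting with `B` blue. -/
def blueAt (R : ColorChangeRule V) (B : Set V) (F : Set (V × V)) : ℕ → Set V
  | 0 => B
  | t + 1 => blueAt R B F t ∪ {w | ∃ u, (u, w) ∈ F ∧ R (blueAt R B F t) u w}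

/-- The propagation time of the set of forces `F` of `B`: the least time at which all vertices are
blue, and `⊤` if there is no such time. -/
noncomputable def ptForces (R : ColorChangeRule V) (B : Set V) (F : Set (V × V)) : ℕ∞ :=
  ⨅ (t : ℕ) (_ : blueAt R B F t = Set.univ), (t : ℕ∞)

/-- The propagation time of `B`: the minimum of the propagation times of its sets of forces. -/
noncomputable def pt (R : ColorChangeRule V) (B : Set V) : ℕ∞ :=
  ⨅ (F : Set (V × V)) (_ : IsSetOfForces R B F), ptForces R B F

/-- The throttling number for the rule `R`: the minimum over all sets `B` of vertices of the number
of vertices of `B` plus the propagation time of `B`. -/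
noncomputable def throttling (R : ColorChangeRule V) : ℕ∞ :=
  ⨅ B : Set V, (B.encard + pt R B)

end ColorChange

/-! ### Positive semidefinite zero forcing -/

section PSD

variable {V : Type*}

/-- The positive semidefinite color change rule on `G`: a blue vertex `u` can force `w` if, for some
connected component `W` of `G - B`, `w` is the only neighbor of `u` in `W`, that is, the only white
neighbor of `u` in `G[B ∪ W]`. -/
def psdRule (G : SimpleGraph V) : ColorChangeRule V := fun B u w =>
  u ∈ B ∧ ∃ W : (G.induce Bᶜ).ConnectedComponent,
    G.neighborSet u ∩ (Subtype.val '' W.supp) = {w}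

/-- The PSD throttling number `th₊(G)`. -/
noncomputable def psdThrottling (G : SimpleGraph V) : ℕ∞ := throttling (psdRule G)

end PSD

/-! ### The graphs `K_a □ T_{k,b}` and their contractions -/

/-- Vertices of `T_{k,b}`: lists of length at most `b` with entries in `Fin k`. The root is the
empty list, the depth is the length, and the children of `l` are the lists `i :: l`. -/
abbrev TreeVertex (k b : ℕ) := {l : List (Fin k) // l.length ≤ b}

/-- The tree `T_{k,b}` of height `b` in which every vertex of depth less than `b` has exactly `k`
children: two vertices are adjacent when one is a child of the other. -/
def karyTree (k b : ℕ) : SimpleGraph (TreeVertex k b) where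
  Adj x y := (∃ i : Fin k, y.1 = i :: x.1) ∨ (∃ i : Fin k, x.1 = i :: y.1)
  symm := ⟨fun _ _ h => h.symm⟩
  loopless := ⟨fun x h => by
    rcases h with ⟨i, h⟩ | ⟨i, h⟩ <;> simpa using congrArg List.length h⟩

/-- The Cartesian product `K_a □ T_{k,b}`. -/
def completeBoxTree (a k b : ℕ) : SimpleGraph (Fin a × TreeVertex k b) :=
  (⊤ : SimpleGraph (Fin a)).boxProd (karyTree k b)

/-- The tree edges of `K_a □ T_{k,b}`: the edges in the copies of `T_{k,b}`. -/
def treeEdges (a k b : ℕ) : Set (Sym2 (Fin a × TreeVertex k b)) :=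
  {e | ∃ (i : Fin a) (x y : TreeVertex k b), (karyTree k b).Adj x y ∧ e = s((i, x), (i, y))}

/-- The complete edges of `K_a □ T_{k,b}`: the edges in the copies of `K_a`. -/
def completeEdges (a k b : ℕ) : Set (Sym2 (Fin a × TreeVertex k b)) :=
  {e | ∃ (i j : Fin a) (x : TreeVertex k b), i ≠ j ∧ e = s((i, x), (j, x))}

/-- The simple graph obtained from `H` by contracting all edges in a set `C` of edges of `H`. Its
vertices are the connected components of the spanning subgraph with edge set `C`; two different ones
are adjacent if some edge of `H` joins them (`SimpleGraph.map` drops loops and merges parallel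
edges). -/
def contractEdges {V : Type*} (H : SimpleGraph V) (C : Set (Sym2 V)) :
    SimpleGraph (SimpleGraph.fromEdgeSet C).ConnectedComponent :=
  H.map (SimpleGraph.fromEdgeSet C).connectedComponentMk

/-- `G` is (up to isomorphism) obtained from `K_a □ T_{k,b}` by contracting tree edges (those
in `C`) and/or deleting complete edges (those in `D`). -/
def IsObtainedFrom {V : Type*} (G : SimpleGraph V) (a k b : ℕ) : Prop :=
  ∃ C ⊆ treeEdges a k b, ∃ D ⊆ completeEdges a k b,
    Nonempty (G ≃g contractEdges ((completeBoxTree a k b).deleteEdges D) C)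

end PSDThrottling

/-!
A propagation process for the PSD rule is recorded by two functions: the time `h w` at which `w`
turns blue, and a parent `p w` that can force `w` once exactly the vertices with smaller time are
blue. By monotonicity of the rule (`psdRule_mono`), `th₊(G) ≤ t` means that some process with
`|{h = 0}| + max h ≤ t` exists (`psdThrottling_le_iff`). On the other side, a contraction of
`K_a □ T_{k,b}` isomorphic to `G` is a quotient map `f` from the product onto `V(G)` whose fibers
are the components of the contracted edges (`nonempty_iso_contractEdges_iff`). So the theorem
translates processes into quotient maps and back.

Given `f`, let `h v` be the least depth in the fiber of `v`, attained at `(i, n)`, and let `p v` be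
the image of `(i, m)` with `m` the parent of `n`. The white vertices whose fibers lie below `n` form
a set closed under white adjacency. A neighbor of `p v` in it other than `v` would place an element
of the fiber of `p v` below `n`; as the fiber is connected by tree edges and contains `(i, m)`, it
would then contain `(i, n)` (`suffix_or_reachable_parent`), which is absurd. Hence the force is valid
(`exists_isPropagation_of_quotientMap`).

Given a process, each initially blue vertex `i` is the root of a forcing tree and gets one copy of
`T_{k,b}`. A vertex of depth `s` of `T_{k,b}` stands for a component of `G` minus the vertices of
time less than `s`, refining the components given by its ancestors (`address`). The vertex `l` of
copy `i` is mapped to the vertex of the tree of `i` that is active at `l` (`branch`): when passing to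
a child of `l` the active vertex `u` is replaced by the vertex it forces in the corresponding
component, which is unique by the PSD rule. Thus tree edges are contracted or mapped to forcing
edges. If `v` is adjacent to a vertex `w` that is still white, `v` cannot force another vertex in the
component of `w`, so it remains active along the address of `w`
(`IsPropagation.branch_address_of_adj`); therefore every edge of `G` that is not a forcing edge is the
image of a complete edge (`IsPropagation.parent_eq_or_branch_eq_of_adj`).
-/

namespace PSDThrottling

open SimpleGraph

/-! ### The PSD color change rule and white components -/

section Rule

variable {V : Type*} {G : SimpleGraph V}

/-- The graph `G - B`, kept on the vertex set of `G`: the vertices of `B` become isolated. -/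
def whiteGraph (G : SimpleGraph V) (B : Set V) : SimpleGraph V where
  Adj x y := G.Adj x y ∧ x ∉ B ∧ y ∉ B
  symm := ⟨fun _ _ h => ⟨h.1.symm, h.2.2, h.2.1⟩⟩
  loopless := ⟨fun _ h => h.1.ne rfl⟩

lemma whiteGraph_anti {B B' : Set V} (h : B ⊆ B') : whiteGraph G B' ≤ whiteGraph G B :=
  fun _ _ hxy => ⟨hxy.1, fun hx => hxy.2.1 (h hx), fun hy => hxy.2.2 (h hy)⟩

lemma reachable_whiteGraph_iff {B : Set V} (x y : (Bᶜ : Set V)) :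
    (whiteGraph G B).Reachable x y ↔ (G.induce Bᶜ).Reachable x y := by
  constructor
  · intro h
    have key : ∀ z : V, (whiteGraph G B).Reachable x z →
        ∃ hz : z ∈ Bᶜ, (G.induce Bᶜ).Reachable x ⟨z, hz⟩ := by
      intro z hz
      rw [reachable_iff_reflTransGen] at hz
      induction hz with
      | refl => exact ⟨x.2, Reachable.refl _⟩
      | tail _ hbc ih =>
        obtain ⟨hb, hr⟩ := ih
        exact ⟨hbc.2.2, hr.trans (Adj.reachable hbc.1)⟩
    exact (key y h).2
  · exact fun h => h.map (⟨Subtype.val, fun {a b} hab => ⟨hab, a.2, b.2⟩⟩ :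
      G.induce Bᶜ →g whiteGraph G B)

lemma psdRule_iff {B : Set V} {u w : V} :
    psdRule G B u w ↔ u ∈ B ∧ w ∉ B ∧ G.Adj u w ∧
      ∀ w', w' ∉ B → G.Adj u w' → (whiteGraph G B).Reachable w w' → w' = w := by
  constructor
  · rintro ⟨hu, W, hW⟩
    have hw : w ∈ G.neighborSet u ∩ (Subtype.val '' W.supp) := by rw [hW]; rfl
    obtain ⟨huw, ⟨w, hwB⟩, hwW, rfl⟩ := hw
    refine ⟨hu, hwB, huw, fun w' hw' huw' hr => ?_⟩
    have : w' ∈ G.neighborSet u ∩ (Subtype.val '' W.supp) := by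
      refine ⟨huw', ⟨w', hw'⟩, ?_, rfl⟩
      rw [ConnectedComponent.mem_supp_iff] at hwW ⊢
      rw [← hwW]
      exact ConnectedComponent.sound ((reachable_whiteGraph_iff ⟨w, hwB⟩ ⟨w', hw'⟩).1 hr).symm
    rw [hW] at this
    exact this
  · rintro ⟨hu, hw, huw, h⟩
    refine ⟨hu, (G.induce Bᶜ).connectedComponentMk ⟨w, hw⟩, ?_⟩
    ext w'
    constructor
    · rintro ⟨hu', ⟨w', hw'⟩, hW, rfl⟩
      rw [ConnectedComponent.mem_supp_iff] at hW
      exact h w' hw' hu'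
        ((reachable_whiteGraph_iff ⟨w, hw⟩ ⟨w', hw'⟩).2 (ConnectedComponent.exact hW).symm)
    · rintro rfl
      exact ⟨huw, ⟨w', hw⟩, rfl, rfl⟩

/-- A force stays valid when more vertices are blue, because the white components shrink. -/
lemma psdRule_mono {B B' : Set V} {u w : V} (h : psdRule G B u w) (hB : B ⊆ B') (hw : w ∉ B') :
    psdRule G B' u w := by
  rw [psdRule_iff] at h ⊢
  exact ⟨hB h.1, hw, h.2.2.1, fun w' hw' huw' hr =>
    h.2.2.2 w' (fun hb => hw' (hB hb)) huw' (hr.mono (whiteGraph_anti hB))⟩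

/-- To verify a force it suffices to exhibit a set `S` of vertices, closed under passing to white
neighbors, in which `w` is the only neighbor of `u`. -/
lemma psdRule_of_closed {B S : Set V} {u w : V} (hu : u ∈ B) (hwB : w ∉ B) (huw : G.Adj u w)
    (hw : w ∈ S) (hS : ∀ x ∈ S, ∀ y, y ∉ B → G.Adj x y → y ∈ S)
    (huniq : ∀ w' ∈ S, G.Adj u w' → w' = w) : psdRule G B u w := by
  rw [psdRule_iff]
  refine ⟨hu, hwB, huw, fun w' hw'B huw' hr => huniq w' ?_ huw'⟩
  clear huw' hw'B
  rw [reachable_iff_reflTransGen] at hr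
  induction hr with
  | refl => exact hw
  | tail _ hbc ih => exact hS _ ih _ hbc.2.2 hbc.1

end Rule

/-! ### Propagation in terms of times and parents -/

section Propagation

variable {V : Type*} {G : SimpleGraph V} {h : V → ℕ} {p : V → V}

/-- `h` and `p` describe a propagation process: `h w` is the time at which `w` turns blue, and every
vertex `w` with `h w = s + 1` can be forced by its parent `p w` when the blue vertices are those
with time at most `s`. The values of `p` on initially blue vertices (those with `h w = 0`) do not
matter. -/
def IsPropagation (G : SimpleGraph V) (h : V → ℕ) (p : V → V) : Prop :=
  ∀ w s, h w = s + 1 → psdRule G {v | h v ≤ s} (p w) w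

lemma IsPropagation.time_parent_lt (hp : IsPropagation G h p) {w : V} (hw : h w ≠ 0) :
    h (p w) < h w := by
  obtain ⟨s, hs⟩ := Nat.exists_eq_succ_of_ne_zero hw
  have := (psdRule_iff.1 (hp w s hs)).1
  simp only [Set.mem_ofPred_eq] at this
  omega

lemma IsPropagation.adj_parent (hp : IsPropagation G h p) {w : V} (hw : h w ≠ 0) :
    G.Adj (p w) w := by
  obtain ⟨s, hs⟩ := Nat.exists_eq_succ_of_ne_zero hw
  exact (psdRule_iff.1 (hp w s hs)).2.2.1

lemma IsPropagation.exists_chronologicalList [Finite V] (hp : IsPropagation G h p) (B : Set V)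
    (hB : {v | h v = 0} ⊆ B) :
    ∃ L, IsChronologicalList (psdRule G) B L ∧ ∀ w, w ∉ B → (p w, w) ∈ L := by
  induction hn : Bᶜ.ncard generalizing B with
  | zero =>
    rw [Set.ncard_eq_zero] at hn
    have hB' : ∀ w, w ∈ B := fun w => by
      by_contra hw
      exact (hn ▸ hw : w ∈ (∅ : Set V))
    exact ⟨[], .nil fun u w huw => (psdRule_iff.1 huw).2.1 (hB' w), fun w hw => (hw (hB' w)).elim⟩
  | succ n ih =>
    have hne : Bᶜ.Nonempty := by
      rw [← Set.ncard_pos]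
      omega
    -- A white vertex that is due at the earliest possible time can be forced right away.
    obtain ⟨w, hw, hmin⟩ := Set.exists_min_image Bᶜ h (Set.toFinite _) hne
    have hw0 : h w ≠ 0 := fun h0 => hw (hB h0)
    obtain ⟨s, hs⟩ := Nat.exists_eq_succ_of_ne_zero hw0
    have hforce : psdRule G B (p w) w := by
      refine psdRule_mono (hp w s hs) (fun v hv => ?_) hw
      by_contra hvB
      have := hmin v hvB
      simp only [Set.mem_ofPred_eq] at hv
      omega
    obtain ⟨L, hL, hmem⟩ := ih (insert w B) (hB.trans (Set.subset_insert w B)) (by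
      have h1 : (insert w B)ᶜ = Bᶜ \ {w} := by
        ext x
        simp [and_comm]
      rw [h1, Set.ncard_sdiff_singleton_of_mem hw]
      omega)
    refine ⟨(p w, w) :: L, .cons hforce hL, fun x hx => ?_⟩
    by_cases hxw : x = w
    · simp [hxw]
    · exact List.mem_cons_of_mem _ (hmem x (by simp [hxw, hx]))

lemma IsPropagation.pt_le [Finite V] (hp : IsPropagation G h p) {b : ℕ} (hb : ∀ v, h v ≤ b) :
    pt (psdRule G) {v | h v = 0} ≤ b := by
  obtain ⟨L, hL, hmem⟩ := hp.exists_chronologicalList {v | h v = 0} subset_rfl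
  have hblue : ∀ s, {v | h v ≤ s} ⊆ blueAt (psdRule G) {v | h v = 0} {q | q ∈ L} s := by
    intro s
    induction s with
    | zero => exact fun v hv => Nat.le_zero.1 hv
    | succ s ih =>
      intro v hv
      by_cases hvs : v ∈ blueAt (psdRule G) {v | h v = 0} {q | q ∈ L} s
      · exact Or.inl hvs
      · have hs : h v = s + 1 := by
          have : ¬ h v ≤ s := fun hle => hvs (ih hle)
          simp only [Set.mem_ofPred_eq] at hv
          omega
        exact Or.inr ⟨p v, hmem v (by simp [hs]), psdRule_mono (hp v s hs) ih hvs⟩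
  refine (iInf₂_le {q | q ∈ L} ⟨L, hL, rfl⟩).trans (iInf₂_le b ?_)
  exact Set.eq_univ_of_forall fun v => hblue b (hb v)

lemma exists_isPropagation_of_blueAt {B : Set V} {F : Set (V × V)} {b : ℕ}
    (hF : blueAt (psdRule G) B F b = Set.univ) :
    ∃ h p, IsPropagation G h p ∧ (∀ v, h v ≤ b) ∧ {v | h v = 0} = B := by
  classical
  have hex : ∀ v, ∃ s, v ∈ blueAt (psdRule G) B F s := fun v => ⟨b, hF ▸ Set.mem_univ v⟩
  have hmono : Monotone (blueAt (psdRule G) B F) :=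
    monotone_nat_of_le_succ fun s => Set.subset_union_left
  have hle : ∀ v s, Nat.find (hex v) ≤ s ↔ v ∈ blueAt (psdRule G) B F s := fun v s =>
    ⟨fun hs => hmono hs (Nat.find_spec (hex v)), fun hv => Nat.find_min' _ hv⟩
  have hpar : ∀ v, ∃ u, ∀ s, Nat.find (hex v) = s + 1 →
      psdRule G (blueAt (psdRule G) B F s) u v := by
    intro v
    rcases hn : Nat.find (hex v) with _ | s
    · exact ⟨v, fun s hs => by omega⟩
    · rcases (hle v (s + 1)).1 hn.le with hv | ⟨u, -, hu⟩
      · have := (hle v s).2 hv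
        omega
      · refine ⟨u, fun s' hs' => ?_⟩
        obtain rfl : s = s' := by omega
        exact hu
  choose p hp using hpar
  refine ⟨fun v => Nat.find (hex v), p, fun w s hs => ?_, fun v => (hle v b).2 (hF ▸ trivial), ?_⟩
  · simp only [hle]
    exact hp w s hs
  · ext v
    rw [Set.mem_ofPred_eq, ← Nat.le_zero, hle]
    rfl

/-- The PSD throttling number as a minimum over propagation processes. -/
lemma psdThrottling_le_iff [Finite V] (t : ℕ) :
    psdThrottling G ≤ t ↔ ∃ h p, IsPropagation G h p ∧
      ∃ b : ℕ, (∀ v, h v ≤ b) ∧ {v | h v = 0}.ncard + b ≤ t := by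
  constructor
  · intro ht
    have hlt : psdThrottling G < ((t + 1 : ℕ) : ℕ∞) :=
      ht.trans_lt (by exact_mod_cast Nat.lt_succ_self t)
    obtain ⟨B, hB⟩ := iInf_lt_iff.1 hlt
    have hpt : pt (psdRule G) B ≠ ⊤ := by
      intro h
      simp [h] at hB
    obtain ⟨m, hm⟩ := ENat.ne_top_iff_exists.1 hpt
    have hlt' : pt (psdRule G) B < ((m + 1 : ℕ) : ℕ∞) := by
      rw [← hm]
      exact_mod_cast Nat.lt_succ_self m
    obtain ⟨F, hF⟩ := iInf_lt_iff.1 hlt'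
    obtain ⟨-, hF⟩ := iInf_lt_iff.1 hF
    obtain ⟨b, hF⟩ := iInf_lt_iff.1 hF
    obtain ⟨hblue, hb⟩ := iInf_lt_iff.1 hF
    obtain ⟨h, p, hp, hle, rfl⟩ := exists_isPropagation_of_blueAt hblue
    refine ⟨h, p, hp, b, hle, ?_⟩
    rw [← hm, ← (Set.toFinite _).cast_ncard_eq] at hB
    have hbm := Nat.cast_lt.1 hb
    have hBt := Nat.cast_lt.1 (by exact_mod_cast hB : ((_ + m : ℕ) : ℕ∞) < ((t + 1 : ℕ) : ℕ∞))
    omega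
  · rintro ⟨h, p, hp, b, hb, hle⟩
    refine (iInf_le _ {v | h v = 0}).trans ((add_le_add le_rfl (hp.pt_le hb)).trans ?_)
    rw [← (Set.toFinite _).cast_ncard_eq]
    exact_mod_cast hle

end Propagation

/-! ### Contractions as quotient maps -/

lemma nonempty_iso_contractEdges_iff {V X : Type*} (G : SimpleGraph V) (H : SimpleGraph X)
    (C : Set (Sym2 X)) :
    Nonempty (G ≃g contractEdges H C) ↔ ∃ f : X → V, Function.Surjective f ∧
      (∀ x y, f x = f y ↔ (fromEdgeSet C).Reachable x y) ∧
      ∀ v w, G.Adj v w ↔ v ≠ w ∧ ∃ x y, H.Adj x y ∧ f x = v ∧ f y = w := by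
  have hadj : ∀ v w, (contractEdges H C).Adj v w ↔ v ≠ w ∧ ∃ x y, H.Adj x y ∧
      (fromEdgeSet C).connectedComponentMk x = v ∧ (fromEdgeSet C).connectedComponentMk y = w := by
    intro v w
    rw [contractEdges, SimpleGraph.map_adj']
  constructor
  · rintro ⟨e⟩
    refine ⟨fun x => e.symm ((fromEdgeSet C).connectedComponentMk x),
      e.symm.surjective.comp Quot.mk_surjective, fun x y => ?_, fun v w => ?_⟩
    · rw [e.symm.injective.eq_iff, ConnectedComponent.eq]
    · rw [← e.map_adj_iff, hadj, e.injective.ne_iff]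
      simp only [← e.symm_apply_eq, eq_comm]
  · rintro ⟨f, hf, hfib, hG⟩
    have hlift : Function.Bijective (fun c : (fromEdgeSet C).ConnectedComponent =>
        c.lift f fun x y q _ => (hfib x y).2 q.reachable) := by
      constructor
      · intro c d
        induction c using ConnectedComponent.ind
        induction d using ConnectedComponent.ind
        exact fun h => ConnectedComponent.sound ((hfib _ _).1 h)
      · intro v
        obtain ⟨x, rfl⟩ := hf v
        exact ⟨(fromEdgeSet C).connectedComponentMk x, rfl⟩
    let e := Equiv.ofBijective _ hlift
    have he : ∀ x, e ((fromEdgeSet C).connectedComponentMk x) = f x := fun x => rfl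
    refine ⟨RelIso.symm ⟨e, fun {c d} => ?_⟩⟩
    rw [hG, hadj, e.injective.ne_iff]
    simp only [← e.injective.eq_iff, he]

/-! ### From a contraction of `K_a □ T_{k,b}` to a propagation process -/

section OfContraction

variable {a k b : ℕ}

lemma eq_and_adj_of_mem_treeEdges {x y : Fin a × TreeVertex k b}
    (h : s(x, y) ∈ treeEdges a k b) : x.1 = y.1 ∧ (karyTree k b).Adj x.2 y.2 := by
  obtain ⟨i, z, z', hz, he⟩ := h
  rcases Sym2.eq_iff.1 he with ⟨rfl, rfl⟩ | ⟨rfl, rfl⟩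
  · exact ⟨rfl, hz⟩
  · exact ⟨rfl, hz.symm⟩

lemma snd_eq_of_mem_completeEdges {x y : Fin a × TreeVertex k b}
    (h : s(x, y) ∈ completeEdges a k b) : x.2 = y.2 := by
  obtain ⟨i, j, z, -, he⟩ := h
  rcases Sym2.eq_iff.1 he with ⟨rfl, rfl⟩ | ⟨rfl, rfl⟩ <;> rfl

/-- The descendants of a tree vertex `c :: l` can be left along tree edges only through the edge
from `c :: l` to its parent `l`. Here `y` is a descendant of `x` when `x` is a suffix of `y`. -/
lemma suffix_or_reachable_parent {C : Set (Sym2 (Fin a × TreeVertex k b))}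
    (hC : C ⊆ treeEdges a k b) {n m : TreeVertex k b} {c : Fin k} (hn : n.1 = c :: m.1)
    {x y : Fin a × TreeVertex k b} (hr : (fromEdgeSet C).Reachable x y) (hx : n.1 <:+ x.2.1) :
    y.1 = x.1 ∧ (n.1 <:+ y.2.1 ∨
      (fromEdgeSet C).Reachable x (x.1, n) ∧ (fromEdgeSet C).Reachable x (x.1, m)) := by
  rw [reachable_iff_reflTransGen] at hr
  induction hr with
  | refl => exact ⟨rfl, Or.inl hx⟩
  | @tail y z hxy hyz ih =>
    obtain ⟨hyx, ih⟩ := ih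
    obtain ⟨hyz1, hyz2⟩ := eq_and_adj_of_mem_treeEdges (hC ((fromEdgeSet_adj C).1 hyz).1)
    refine ⟨hyz1 ▸ hyx, ?_⟩
    rcases ih with ih | ih
    · rcases hyz2 with ⟨d, hd⟩ | ⟨d, hd⟩
      · rw [hd]
        exact Or.inl (ih.trans (List.suffix_cons d y.2.1))
      · rw [hd, List.suffix_cons_iff] at ih
        rcases ih with ih | ih
        · right
          have hxy' : (fromEdgeSet C).Reachable x y := (reachable_iff_reflTransGen _ _).2 hxy
          have hy : y = (x.1, n) := Prod.ext hyx (Subtype.ext (hd.trans ih.symm))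
          have hz : z = (x.1, m) := by
            refine Prod.ext (hyz1 ▸ hyx) (Subtype.ext ?_)
            rw [hn] at ih
            exact (List.cons.inj ih).2.symm
          exact ⟨hy ▸ hxy', hz ▸ hxy'.trans (Adj.reachable hyz)⟩
        · exact Or.inl ih
    · exact Or.inr ih

/-- A quotient map from `K_a □ T_{k,b}` onto `G` yields a propagation process: a vertex turns blue
at the least depth occurring in its fiber, forced by the image of the tree vertex just above. -/
lemma exists_isPropagation_of_quotientMap {V : Type*} {G : SimpleGraph V}
    {C D : Set (Sym2 (Fin a × TreeVertex k b))} (hC : C ⊆ treeEdges a k b)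
    (hD : D ⊆ completeEdges a k b) {f : Fin a × TreeVertex k b → V} (hf : Function.Surjective f)
    (hfib : ∀ x y, f x = f y ↔ (fromEdgeSet C).Reachable x y)
    (hG : ∀ v w, G.Adj v w ↔
      v ≠ w ∧ ∃ x y, ((completeBoxTree a k b).deleteEdges D).Adj x y ∧ f x = v ∧ f y = w) :
    ∃ h p, IsPropagation G h p ∧ (∀ v, h v ≤ b) ∧ {v | h v = 0}.ncard ≤ a := by
  have htop : ∀ v, ∃ x, f x = v ∧ ∀ y, f y = v → x.2.1.length ≤ y.2.1.length := by
    intro v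
    obtain ⟨x, hx, hmin⟩ := (measure fun x : Fin a × TreeVertex k b => x.2.1.length).wf.has_min
      (f ⁻¹' {v}) (hf v)
    exact ⟨x, hx, fun y hy => not_lt.1 (hmin y hy)⟩
  choose top hftop hmin using htop
  have hbox : ∀ {x y}, ((completeBoxTree a k b).deleteEdges D).Adj x y →
      x.2 = y.2 ∨ (x.1 = y.1 ∧ (karyTree k b).Adj x.2 y.2) := by
    intro x y hxy
    rcases boxProd_adj.1 (deleteEdges_le D hxy) with hxy | hxy
    · exact Or.inl hxy.2
    · exact Or.inr ⟨hxy.2, hxy.1⟩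
  have hlen : ∀ x : TreeVertex k b, x.1.tail.length ≤ b := fun x => by
    have := x.2
    rw [List.length_tail]
    omega
  refine ⟨fun v => (top v).2.1.length,
    fun v => f ((top v).1, ⟨(top v).2.1.tail, hlen (top v).2⟩), fun w s hs => ?_,
    fun v => (top v).2.2, ?_⟩
  · set i := (top w).1
    set n := (top w).2
    set m : TreeVertex k b := ⟨n.1.tail, hlen n⟩ with hm
    replace hs : n.1.length = s + 1 := hs
    obtain ⟨c, l, hcl⟩ := List.exists_cons_of_length_eq_add_one hs
    have hnm : n.1 = c :: m.1 := by simp [hm, hcl]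
    have hml : m.1.length = s := by
      rw [hnm, List.length_cons] at hs
      omega
    have hfn : f (i, n) = w := hftop w
    have hparent : (top (f (i, m))).2.1.length ≤ s := (hmin _ _ rfl).trans hml.le
    have hne : f (i, m) ≠ w := by
      intro he
      rw [he] at hparent
      exact absurd (hs.symm.le.trans hparent) (by omega)
    have hnotm : ¬ n.1 <:+ m.1 := fun hsuf => by
      have := hsuf.length_le
      omega
    -- The position `n` cannot be left within a fiber, unless the fiber contains its parent `m`.
    have hexit : ∀ x y, f x = f y → n.1 <:+ x.2.1 → ¬ n.1 <:+ y.2.1 →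
        f x = f (x.1, n) ∧ f x = f (x.1, m) := by
      intro x y hxy hx hy
      have := ((suffix_or_reachable_parent hC hnm ((hfib x y).1 hxy) hx).2).resolve_left hy
      exact ⟨(hfib _ _).2 this.1, (hfib _ _).2 this.2⟩
    have hstay : ∀ x y, f x = f y → n.1 <:+ x.2.1 → s < (top (f x)).2.1.length →
        n.1 <:+ y.2.1 := by
      intro x y hxy hx hlt
      by_contra hy
      have hle : _ ≤ m.1.length := hmin (f x) _ (hexit x y hxy hx hy).2.symm
      omega
    refine psdRule_of_closed
      (S := {v | s < (top v).2.1.length ∧ ∃ x, f x = v ∧ n.1 <:+ x.2.1}) hparent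
      (by simpa using hs.symm.le) ?_ ⟨hs.symm.le, (i, n), hfn, List.suffix_rfl⟩ ?_ ?_
    · refine (hG _ _).2 ⟨hne, (i, m), (i, n), ?_, rfl, hfn⟩
      rw [deleteEdges_adj]
      refine ⟨boxProd_adj.2 (Or.inr ⟨Or.inl ⟨c, hnm⟩, rfl⟩), fun hmem => ?_⟩
      have hmn : m = n := snd_eq_of_mem_completeEdges (hD hmem)
      rw [hmn] at hml
      omega
    · rintro v ⟨hv, x₀, rfl, hx₀⟩ v' hv' hadj
      simp only [Set.mem_ofPred_eq, not_le] at hv'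
      obtain ⟨-, x, y, hxy, hx, rfl⟩ := (hG _ _).1 hadj
      have hnx : n.1 <:+ x.2.1 := hstay x₀ x hx.symm hx₀ hv
      refine ⟨hv', y, rfl, ?_⟩
      rcases hbox hxy with he | ⟨-, ⟨d, hd⟩ | ⟨d, hd⟩⟩
      · exact he ▸ hnx
      · rw [hd]
        exact hnx.trans (List.suffix_cons d x.2.1)
      · rw [hd, List.suffix_cons_iff] at hnx
        refine hnx.resolve_left fun he => ?_
        have h1 := congrArg List.length he
        have h2 := hmin (f y) y rfl
        rw [List.length_cons] at h1
        omega
    · rintro w' ⟨hw', y₀, rfl, hy₀⟩ hadj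
      obtain ⟨-, x, y, hxy, hx, hy⟩ := (hG _ _).1 hadj
      have hny : n.1 <:+ y.2.1 := hstay y₀ y hy.symm hy₀ hw'
      have hnx : ¬ n.1 <:+ x.2.1 := by
        intro hnx
        have hxi : x.1 = i :=
          ((suffix_or_reachable_parent hC hnm ((hfib x (i, m)).1 hx) hnx).1).symm
        have := (hexit x (i, m) hx hnx hnotm).1
        rw [hxi, hfn, hx] at this
        exact hne this
      have hxi : x.1 = i := by
        have hr := (hfib (i, m) x).1 hx.symm
        clear * - hr hC
        rw [reachable_iff_reflTransGen] at hr
        induction hr with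
        | refl => rfl
        | tail _ hyz ih =>
          exact (eq_and_adj_of_mem_treeEdges (hC ((fromEdgeSet_adj C).1 hyz).1)).1.symm.trans ih
      rcases hbox hxy with he | ⟨hxy1, ⟨d, hd⟩ | ⟨d, hd⟩⟩
      · exact (hnx (he ▸ hny)).elim
      · rw [hd, List.suffix_cons_iff] at hny
        rcases hny with he | hsuf
        · have : y = (i, n) := Prod.ext (hxy1 ▸ hxi) (Subtype.ext (hd.trans he.symm))
          rw [← hy, this, hfn]
        · exact (hnx hsuf).elim
      · exact (hnx (hd ▸ hny.trans (List.suffix_cons d y.2.1))).elim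
  · have hsub : {v | (top v).2.1.length = 0} ⊆
        (fun i : Fin a => f (i, ⟨[], Nat.zero_le b⟩)) '' Set.univ := by
      intro v hv
      refine ⟨(top v).1, trivial, ?_⟩
      have hv' : top v = ((top v).1, ⟨[], Nat.zero_le b⟩) :=
        Prod.ext rfl (Subtype.ext (List.length_eq_zero_iff.1 hv))
      exact (congrArg f hv').symm.trans (hftop v)
    calc _ ≤ _ := Set.ncard_le_ncard hsub (Set.toFinite _)
      _ ≤ (Set.univ : Set (Fin a)).ncard := Set.ncard_image_le (Set.toFinite _)
      _ = a := by simp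

end OfContraction

/-! ### From a propagation process to a contraction of `K_a □ T_{k,b}` -/

section ToContraction

variable {V : Type*} {G : SimpleGraph V} {h : V → ℕ} {p : V → V}

/-- A vertex of the component of `w` in `G - B`, depending on this component only. -/
noncomputable def componentRep (G : SimpleGraph V) (B : Set V) (w : V) : V :=
  ((whiteGraph G B).connectedComponentMk w).nonempty_supp.some

lemma componentRep_eq_iff {B : Set V} {v w : V} :
    componentRep G B v = componentRep G B w ↔ (whiteGraph G B).Reachable v w := by
  have hmem : ∀ x, (whiteGraph G B).connectedComponentMk (componentRep G B x) =
      (whiteGraph G B).connectedComponentMk x := fun x =>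
    ((whiteGraph G B).connectedComponentMk x).nonempty_supp.some_mem
  constructor
  · intro hvw
    rw [← ConnectedComponent.eq, ← hmem v, hvw, hmem w]
  · intro hvw
    simp only [componentRep, ConnectedComponent.sound hvw]

/-- The sequence of components, of `G` minus the vertices of time at most `r` for
`r = s - 1, …, 1, 0`, that contain `w`. Each component is encoded by a chosen vertex in it. This is
meaningful for `s ≤ h w` only, as otherwise `w` is not a vertex of all these graphs. -/
noncomputable def address (G : SimpleGraph V) (h : V → ℕ) : ℕ → V → List V
  | 0, _ => []
  | s + 1, w => componentRep G {v | h v ≤ s} w :: address G h s w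

@[simp]
lemma length_address (s : ℕ) (w : V) : (address G h s w).length = s := by
  induction s with
  | zero => rfl
  | succ s ih => rw [address, List.length_cons, ih]

lemma reachable_of_address_succ_eq {s : ℕ} {v w : V}
    (hvw : address G h (s + 1) v = address G h (s + 1) w) :
    (whiteGraph G {v | h v ≤ s}).Reachable v w :=
  componentRep_eq_iff.1 (List.cons.inj hvw).1

lemma address_eq_of_adj {s : ℕ} {v w : V} (hvw : G.Adj v w) (hv : s ≤ h v) (hw : s ≤ h w) :
    address G h s v = address G h s w := by
  induction s with
  | zero => rfl
  | succ s ih =>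
    have hadj : (whiteGraph G {v | h v ≤ s}).Adj v w := by
      refine ⟨hvw, ?_, ?_⟩ <;> simp only [Set.mem_ofPred_eq] <;> omega
    rw [address, address, ih (by omega) (by omega),
      componentRep_eq_iff.2 (Adj.reachable hadj)]

open Classical in
/-- The active vertex of the forcing tree with root `i` at the tree vertex with address `l`: passing
from `l` to its child `c :: l`, the active vertex is replaced by the vertex which it forces at that
moment in the component encoded by `c :: l`, if there is one, and remains the same otherwise. -/
noncomputable def branch (G : SimpleGraph V) (h : V → ℕ) (p : V → V) (i : V) : List V → V
  | [] => i
  | c :: l =>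
    if hw : ∃ w, h w = l.length + 1 ∧ p w = branch G h p i l ∧
      address G h (l.length + 1) w = c :: l then hw.choose else branch G h p i l

lemma branch_cons (i c : V) (l : List V) :
    branch G h p i (c :: l) = branch G h p i l ∨
      h (branch G h p i (c :: l)) = l.length + 1 ∧
      p (branch G h p i (c :: l)) = branch G h p i l ∧
      address G h (l.length + 1) (branch G h p i (c :: l)) = c :: l := by
  by_cases hw : ∃ w, h w = l.length + 1 ∧ p w = branch G h p i l ∧
      address G h (l.length + 1) w = c :: l
  · right
    rw [branch, dif_pos hw]
    exact hw.choose_spec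
  · left
    rw [branch, dif_neg hw]

namespace IsPropagation

lemma eq_of_address_eq (hp : IsPropagation G h p) {s : ℕ} {x w : V} (hx : h x = s + 1)
    (hw : s < h w) (hadj : G.Adj (p x) w)
    (hadd : address G h (s + 1) x = address G h (s + 1) w) : w = x :=
  (psdRule_iff.1 (hp x s hx)).2.2.2 w (by simpa using hw) hadj (reachable_of_address_succ_eq hadd)

lemma branch_address_succ (hp : IsPropagation G h p) {i w : V} {s : ℕ} (hw : h w = s + 1)
    (hb : branch G h p i (address G h s w) = p w) :
    branch G h p i (address G h (s + 1) w) = w := by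
  have hex : ∃ x, h x = (address G h s w).length + 1 ∧
      p x = branch G h p i (address G h s w) ∧
      address G h ((address G h s w).length + 1) x =
        componentRep G {v | h v ≤ s} w :: address G h s w :=
    ⟨w, by simpa using hw, hb.symm, by rw [length_address, address]⟩
  rw [address, branch, dif_pos hex]
  obtain ⟨h1, h2, h3⟩ := hex.choose_spec
  generalize hex.choose = x at h1 h2 h3 ⊢
  rw [length_address] at h1 h3
  exact (hp.eq_of_address_eq h1 (by omega)
    (by rw [h2, hb]; exact hp.adj_parent (by omega)) h3).symm

/-- Once `v` is active, it remains so on the way to a neighbor `w` of `v` until `w` turns blue: as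
long as `w` is white, `v` cannot force a vertex other than `w` in the component of `w`. -/
lemma branch_address_of_adj (hp : IsPropagation G h p) {i v w : V} {r : ℕ} (hvw : G.Adj v w)
    (hb : branch G h p i (address G h (h v) v) = v) (hvr : h v ≤ r) (hrw : r < h w) :
    branch G h p i (address G h r w) = v := by
  induction r, hvr using Nat.le_induction with
  | base => rw [← address_eq_of_adj hvw le_rfl hrw.le, hb]
  | succ r _ ih =>
    have ih := ih (by omega)
    rw [address]
    rcases branch_cons (G := G) (h := h) (p := p) i
      (componentRep G {v | h v ≤ r} w) (address G h r w) with
      he | ⟨h1, h2, h3⟩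
    · rw [he, ih]
    · rw [length_address] at h1 h3
      have := hp.eq_of_address_eq h1 (w := w) (by omega) (by rw [h2, ih]; exact hvw) h3
      rw [← this] at h1
      omega

end IsPropagation

/-- The initially blue vertex from which `v` is reached by a chain of forces. -/
def root (h : V → ℕ) (p : V → V) (v : V) : V :=
  if h (p v) < h v then root h p (p v) else v
termination_by h v

namespace IsPropagation

lemma root_eq_root_parent (hp : IsPropagation G h p) {v : V} (hv : h v ≠ 0) :
    root h p v = root h p (p v) := by
  rw [root, if_pos (hp.time_parent_lt hv)]

lemma root_of_time_eq_zero {v : V} (hv : h v = 0) : root h p v = v := by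
  rw [root, if_neg (by omega)]

lemma time_root (hp : IsPropagation G h p) (v : V) : h (root h p v) = 0 := by
  induction hn : h v using Nat.strong_induction_on generalizing v with
  | _ n ih =>
    by_cases hv : h v = 0
    · rwa [root_of_time_eq_zero hv]
    · rw [hp.root_eq_root_parent hv]
      exact ih _ (hn ▸ hp.time_parent_lt hv) _ rfl

lemma branch_root_address (hp : IsPropagation G h p) (v : V) :
    branch G h p (root h p v) (address G h (h v) v) = v := by
  induction hn : h v using Nat.strong_induction_on generalizing v with
  | _ n ih =>
    rcases n with _ | s
    · rw [root_of_time_eq_zero hn, address, branch]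
    · have hv : h v ≠ 0 := by omega
      have hlt := hp.time_parent_lt hv
      have hpar := ih _ (hn ▸ hlt) (p v) rfl
      rw [hp.root_eq_root_parent hv]
      exact hp.branch_address_succ hn
        (hp.branch_address_of_adj (hp.adj_parent hv) hpar (by omega) (by omega))

lemma root_branch (hp : IsPropagation G h p) {i : V} (hi : h i = 0) (l : List V) :
    root h p (branch G h p i l) = i := by
  induction l with
  | nil => exact root_of_time_eq_zero hi
  | cons c l ih =>
    rcases branch_cons (G := G) (h := h) (p := p) i c l with he | ⟨h1, h2, -⟩
    · rw [he, ih]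
    · rw [hp.root_eq_root_parent (by omega), h2, ih]

/-- Every edge of `G` consists of two active vertices of different forcing trees at the same tree vertex,
or of a vertex and its parent. -/
lemma parent_eq_or_branch_eq_of_adj (hp : IsPropagation G h p) {v w : V} (hvw : G.Adj v w)
    (hle : h v ≤ h w) :
    p w = v ∧ h v < h w ∨
      root h p v ≠ root h p w ∧ branch G h p (root h p v) (address G h (h w) w) = v := by
  have hbv := hp.branch_root_address v
  have hbw := hp.branch_root_address w
  rcases hle.eq_or_lt with he | hlt
  · have hb : branch G h p (root h p v) (address G h (h w) w) = v := by
      rw [← he, ← address_eq_of_adj hvw le_rfl he.le, hbv]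
    refine Or.inr ⟨fun hroot => ?_, hb⟩
    rw [hroot, hbw] at hb
    exact hvw.ne hb.symm
  · by_cases hpw : p w = v
    · exact Or.inl ⟨hpw, hlt⟩
    · obtain ⟨s, hs⟩ := Nat.exists_eq_succ_of_ne_zero (show h w ≠ 0 by omega)
      have hbs := hp.branch_address_of_adj hvw hbv (show h v ≤ s by omega) (by omega)
      refine Or.inr ⟨fun hroot => hpw ?_, ?_⟩
      · have hw0 : h w ≠ 0 := by omega
        have hlt' := hp.time_parent_lt hw0
        rw [hroot, hp.root_eq_root_parent hw0] at hbs
        rw [← hbs]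
        exact (hp.branch_address_of_adj (hp.adj_parent hw0) (hp.branch_root_address (p w))
          (by omega) (by omega)).symm
      · rw [hs, Nat.succ_eq_add_one, address]
        rcases branch_cons (G := G) (h := h) (p := p) (root h p v)
          (componentRep G {v | h v ≤ s} w) (address G h s w) with
          he | ⟨h1, h2, h3⟩
        · rw [he, hbs]
        · rw [length_address] at h1 h3
          have hw := hp.eq_of_address_eq h1 (w := w) (by omega) (by rw [h2, hbs]; exact hvw) h3
          rw [← hw, hbs] at h2
          exact (hpw h2).elim

/-- The tree vertices `l` of the copy of `T_{k,b}` belonging to a forcing tree are mapped to the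
active vertices at `l`; for `k = |V|` there are enough children to encode all components. -/
lemma isObtainedFrom [Finite V] (hp : IsPropagation G h p) {b : ℕ} (hb : ∀ v, h v ≤ b) :
    IsObtainedFrom G {v | h v = 0}.ncard (Nat.card V) b := by
  set a := {v | h v = 0}.ncard
  set k := Nat.card V
  let β : Fin a ≃ {v // h v = 0} :=
    (finCongr (Nat.card_coe_set_eq {v | h v = 0}).symm).trans (Finite.equivFin _).symm
  let e : Fin k ≃ V := (Finite.equivFin V).symm
  let f : Fin a × TreeVertex k b → V := fun x => branch G h p (β x.1) (x.2.1.map e)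
  let node : (s : ℕ) → V → s ≤ b → TreeVertex k b := fun s w hs =>
    ⟨(address G h s w).map e.symm, by simpa using hs⟩
  have hnode : ∀ i s w hs, f (i, node s w hs) = branch G h p (β i) (address G h s w) := by
    intro i s w hs
    simp [f, node]
  let tree : V → Fin a := fun v => β.symm ⟨root h p v, hp.time_root v⟩
  have htree : ∀ v, (β (tree v)).1 = root h p v := fun v => by simp [tree]
  let pos : V → Fin a × TreeVertex k b := fun v => (tree v, node (h v) v (hb v))
  have hpos : ∀ v, f (pos v) = v := by
    intro v
    exact (hnode _ _ _ (hb v)).trans (by rw [htree, hp.branch_root_address])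
  let C : Set (Sym2 (Fin a × TreeVertex k b)) :=
    {q | q ∈ treeEdges a k b ∧ ∃ x y, q = s(x, y) ∧ f x = f y}
  let D : Set (Sym2 (Fin a × TreeVertex k b)) :=
    {q | q ∈ completeEdges a k b ∧ ∃ x y, q = s(x, y) ∧ ¬ G.Adj (f x) (f y)}
  have hD : ∀ {x y}, s(x, y) ∈ D → ¬ G.Adj (f x) (f y) := by
    rintro x y ⟨-, x', y', he, hn⟩
    rcases Sym2.eq_iff.1 he with ⟨rfl, rfl⟩ | ⟨rfl, rfl⟩
    · exact hn
    · exact fun hadj => hn hadj.symm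
  have hfC : ∀ {x y}, (fromEdgeSet C).Reachable x y → f x = f y := by
    intro x y hr
    rw [reachable_iff_reflTransGen] at hr
    induction hr with
    | refl => rfl
    | tail _ hyz ih =>
      obtain ⟨⟨-, x', y', he, hf⟩, -⟩ := (fromEdgeSet_adj C).1 hyz
      rcases Sym2.eq_iff.1 he with ⟨rfl, rfl⟩ | ⟨rfl, rfl⟩
      · exact ih.trans hf
      · exact ih.trans hf.symm
  -- Every fiber is connected: going up from any of its elements, one arrives at `pos`.
  have hup : ∀ (i : Fin a) (l : List (Fin k)) (hl : l.length ≤ b),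
      (fromEdgeSet C).Reachable (i, ⟨l, hl⟩) (pos (f (i, ⟨l, hl⟩))) := by
    intro i l hl
    have htreef : ∀ x, tree (f (i, x)) = i := fun x => by
      apply β.injective
      apply Subtype.ext
      rw [htree]
      exact hp.root_branch (β i).2 _
    induction l with
    | nil =>
      have h0 : h (f (i, ⟨[], hl⟩)) = 0 := (β i).2
      refine (congrArg _ (Prod.ext (htreef _).symm (Subtype.ext ?_))).mp (Reachable.refl _)
      simp [pos, node, h0, address]
    | cons c l ih =>
      have hl' : l.length ≤ b := by
        rw [List.length_cons] at hl
        omega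
      rcases branch_cons (G := G) (h := h) (p := p) (β i) (e c) (l.map e) with he | ⟨h1, -, h3⟩
      · have he' : f (i, ⟨c :: l, hl⟩) = f (i, ⟨l, hl'⟩) := he
        rw [he']
        refine Reachable.trans (Adj.reachable ?_) (ih hl')
        refine (fromEdgeSet_adj C).2 ⟨⟨⟨i, _, _, Or.inr ⟨c, rfl⟩, rfl⟩, _, _, rfl, he'⟩, ?_⟩
        intro heq
        simpa using congrArg (fun x => x.2.1.length) heq
      · refine (congrArg _ (Prod.ext (htreef _).symm (Subtype.ext ?_))).mp (Reachable.refl _)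
        have h4 : address G h (h (f (i, ⟨c :: l, hl⟩))) (f (i, ⟨c :: l, hl⟩)) = e c :: l.map e := by
          change address G h (h (branch G h p (β i) (e c :: l.map e))) _ = _
          rw [h1]
          exact h3
        simp [pos, node, h4]
  have hedge : ∀ v w, G.Adj v w → h v ≤ h w →
      ∃ x y, ((completeBoxTree a k b).deleteEdges D).Adj x y ∧ f x = v ∧ f y = w := by
    intro v w hvw hle
    rcases hp.parent_eq_or_branch_eq_of_adj hvw hle with ⟨hpw, hlt⟩ | ⟨hne, hbr⟩
    · obtain ⟨s, hs⟩ := Nat.exists_eq_succ_of_ne_zero (show h w ≠ 0 by omega)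
      have hsb : s ≤ b := by
        have := hb w
        omega
      have hfv : f (tree w, node s w hsb) = v := by
        rw [hnode _ _ _ hsb, htree, hp.root_eq_root_parent (by omega), hpw]
        exact hp.branch_address_of_adj hvw (hp.branch_root_address v) (by omega) (by omega)
      refine ⟨(tree w, node s w hsb), pos w, ?_, hfv, hpos w⟩
      rw [deleteEdges_adj]
      refine ⟨boxProd_adj.2 (Or.inr ⟨Or.inl ?_, rfl⟩), fun hmem => hD hmem ?_⟩
      · simp [pos, node, hs, address]
      · rw [hfv, hpos]
        exact hvw
    · have hfv : f (tree v, node (h w) w (hb w)) = v := by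
        rw [hnode _ _ _ (hb w), htree, hbr]
      refine ⟨(tree v, node (h w) w (hb w)), pos w, ?_, hfv, hpos w⟩
      rw [deleteEdges_adj]
      refine ⟨boxProd_adj.2 (Or.inl ⟨?_, rfl⟩), fun hmem => hD hmem ?_⟩
      · intro (heq : tree v = tree w)
        exact hne (by rw [← htree, ← htree, heq])
      · rw [hfv, hpos]
        exact hvw
  have hchild : ∀ (i : Fin a) (x y : TreeVertex k b) (c : Fin k), y.1 = c :: x.1 →
      f (i, x) = f (i, y) ∨ G.Adj (f (i, x)) (f (i, y)) := by
    rintro i ⟨x, hx⟩ ⟨_, hy⟩ c rfl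
    rcases branch_cons (G := G) (h := h) (p := p) (β i) (e c) (x.map e) with he | ⟨h1, h2, -⟩
    · exact Or.inl he.symm
    · right
      have := hp.adj_parent (w := branch G h p (β i) (e c :: x.map e)) (by omega)
      rw [h2] at this
      exact this
  refine ⟨C, fun _ hq => hq.1, D, fun _ hq => hq.1, ?_⟩
  refine (nonempty_iso_contractEdges_iff G _ C).2 ⟨f, fun v => ⟨pos v, hpos v⟩, fun x y => ?_, ?_⟩
  · refine ⟨fun hxy => ?_, hfC⟩
    have hx := hup x.1 x.2.1 x.2.2
    have hy := hup y.1 y.2.1 y.2.2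
    exact hx.trans (((congrArg pos hxy).symm ▸ hy.symm : _))
  · intro v w
    constructor
    · intro hvw
      refine ⟨hvw.ne, ?_⟩
      rcases le_total (h v) (h w) with hle | hle
      · exact hedge v w hvw hle
      · obtain ⟨x, y, hxy, hx, hy⟩ := hedge w v hvw.symm hle
        exact ⟨y, x, hxy.symm, hy, hx⟩
    · rintro ⟨hne, ⟨i, x⟩, ⟨j, y⟩, hxy, rfl, rfl⟩
      rw [deleteEdges_adj] at hxy
      obtain ⟨hxy, hnD⟩ := hxy
      rcases boxProd_adj.1 hxy with ⟨hij, hx⟩ | ⟨hx, hij⟩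
      · obtain rfl : x = y := hx
        by_contra hn
        exact hnD ⟨⟨i, j, x, hij, rfl⟩, _, _, rfl, hn⟩
      · obtain rfl : i = j := hij
        rcases hx with ⟨c, hc⟩ | ⟨c, hc⟩
        · exact (hchild i x y c hc).resolve_left hne
        · exact ((hchild i y x c hc).resolve_left hne.symm).symm

end IsPropagation

end ToContraction

end PSDThrottling

theorem theorem2p6 {V : Type*} [Finite V] [Nonempty V] (G : SimpleGraph V) (t : ℕ) (ht : 0 < t) :
    PSDThrottling.psdThrottling G ≤ (t : ℕ∞) ↔
      ∃ a k b : ℕ, 0 < a ∧ 0 < k ∧ a + b = t ∧ PSDThrottling.IsObtainedFrom G a k b := by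
  rw [PSDThrottling.psdThrottling_le_iff]
  constructor
  · rintro ⟨h, p, hp, b, hb, hle⟩
    have ha : 0 < {v | h v = 0}.ncard := by
      rw [Set.ncard_pos]
      exact ⟨PSDThrottling.root h p (Classical.arbitrary V), hp.time_root _⟩
    exact ⟨_, Nat.card V, t - {v | h v = 0}.ncard, ha, Nat.card_pos, by omega,
      hp.isObtainedFrom fun v => (hb v).trans (by omega)⟩
  · rintro ⟨a, k, b, -, -, hab, C, hC, D, hD, hG⟩
    obtain ⟨f, hf, hfib, hadj⟩ := (PSDThrottling.nonempty_iso_contractEdges_iff G _ C).1 hG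
    obtain ⟨h, p, hp, hb, ha⟩ :=
      PSDThrottling.exists_isPropagation_of_quotientMap hC hD hf hfib hadj
    exact ⟨h, p, hp, b, hb, by omega⟩
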